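/- Let $n\ge 2$ and let $H\in C^0(\mathbb R^n)$ be convex and coercive ($H(p)\to\infty$ as $|p|\to\infty$), and assume (A) for every $c\in\mathbb R$ the level set $H^{-1}(c)$ contains no nondegenerate line segment. For an open set $V\subset\mathbb R^n$ and $u\in W^{1,\infty}_{\rm loc}(V)$ put $\mathcal F_H(u,V)=\operatorname{ess\,sup}_{x\in V}H(Du(x))$. Write $u\in AM_H(\mathbb R^n)$ if $u\in W^{1,\infty}_{\rm loc}(\mathbb R^n)$ (identified with its continuous representative) and $\mathcal F_H(u,V)\le \mathcal F_H(v,V)$ for every open $V\Subset\mathbb R^n$ and every $v\in W^{1,\infty}_{\rm loc}(V)\cap C(\overline V)$ with $v=u$ on $\partial V$. Write $\|H(Du)\|_{L^\infty(V)}$ for $\mathcal F_H(u,V)$ (this is the usual norm if $H\ge 0$), and $Su(x)=\lim_{r\to0^+}\|H(Du)\|_{L^\infty(B(x,r))}$. Then: (B-1) If $u\in AM_H(\mathbb R^n)$ and $Su(x_0)=\|H(Du)\|_{L^\infty(\mathbb R^n)}<\infty$ for some $x_0\in\mathbb R^n$, then $u$ is affine, i.e. $u(x)=p\cdot x+b$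 for some $p\in\mathbb R^n$, $b\in\mathbb R$, and $H(Du(x_0))=\|H(Du)\|_{L^\infty(\mathbb R^n)}$. (B-2) If $u\in AM_H(\mathbb R^n)$ has linear growth at infinity, i.e. there is $C>0$ with $|u(x)|\le C(1+|x|)$ for all $x\in\mathbb R^n$, then $u$ has the linear approximation property at infinity: for every sequence $R_j\to\infty$ there are a subsequence $R_{j_k}$ and a vector $e\in\mathbb R^n$ such that $$\lim_{k\to\infty}\ \sup_{y\in B(0,1)}\left|\frac{u(R_{j_k}y)}{R_{j_k}}-e\cdot y\right|=0\qquad\text{and}\qquad H(e)=\|H(Du)\|_{L^\infty(\mathbb R^n)}.$$ -/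

import Mathlib

open MeasureTheory Filter Topology Set Metric
open scoped ContDiff

/-- `g` is the weak (distributional) gradient of `u` on the open set `U`: both are locally
integrable on `U`, and `∫_U u ∂_w φ = - ∫_U φ ⟨g, w⟩` for every direction `w` and every smooth test
function `φ` with compact support in `U`. -/
structure HasWeakGradOn {n : ℕ} (u : EuclideanSpace ℝ (Fin n) → ℝ)
    (g : EuclideanSpace ℝ (Fin n) → EuclideanSpace ℝ (Fin n))
    (U : Set (EuclideanSpace ℝ (Fin n))) : Prop where
  locallyIntegrableOn_fun : LocallyIntegrableOn u U volume
  locallyIntegrableOn_grad : LocallyIntegrableOn g U volume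
  integral_eq : ∀ φ : EuclideanSpace ℝ (Fin n) → ℝ, ContDiff ℝ ∞ φ → HasCompactSupport φ →
    tsupport φ ⊆ U → ∀ w : EuclideanSpace ℝ (Fin n),
      ∫ x in U, u x * fderiv ℝ φ x w = - ∫ x in U, φ x * inner ℝ (g x) w

/-- Membership in the Sobolev space `W^{1,∞}_loc(U)`: `u` has a weak gradient on `U`, and `u` and
its weak gradient are essentially bounded on every compact subset of `U`. -/
def MemSobolevLoc {n : ℕ} (u : EuclideanSpace ℝ (Fin n) → ℝ)
    (U : Set (EuclideanSpace ℝ (Fin n))) : Prop :=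
  ∃ g : EuclideanSpace ℝ (Fin n) → EuclideanSpace ℝ (Fin n), HasWeakGradOn u g U ∧
    ∀ K : Set (EuclideanSpace ℝ (Fin n)), IsCompact K → K ⊆ U →
      MemLp u ⊤ (volume.restrict K) ∧ MemLp g ⊤ (volume.restrict K)

open Classical in
/-- The weak gradient `Du` of `u` on `U` (unique up to a null set of `U` when it exists;
`0` by convention if `u` has no weak gradient on `U`). -/
noncomputable def weakGrad {n : ℕ} (u : EuclideanSpace ℝ (Fin n) → ℝ)
    (U : Set (EuclideanSpace ℝ (Fin n))) : EuclideanSpace ℝ (Fin n) → EuclideanSpace ℝ (Fin n) :=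
  if h : ∃ g, HasWeakGradOn u g U then h.choose else 0

/-- The supremal functional `F_H(u, U) = ess sup_{x ∈ U} H(Du(x))`, with extended real values. -/
noncomputable def supFunctional {n : ℕ} (H : EuclideanSpace ℝ (Fin n) → ℝ)
    (u : EuclideanSpace ℝ (Fin n) → ℝ) (U : Set (EuclideanSpace ℝ (Fin n))) : EReal :=
  essSup (fun x => (H (weakGrad u U x) : EReal)) (volume.restrict U)

/-- `u ∈ AM_H(Ω)`: `u` is (the continuous representative of) a function in `W^{1,∞}_loc(Ω)`, and
`F_H(u, V) ≤ F_H(v, V)` for every open `V` compactly contained in `Ω` and every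
`v ∈ W^{1,∞}_loc(V) ∩ C(closure V)` that agrees with `u` on the boundary of `V`. -/
structure IsAbsoluteMinimizer {n : ℕ} (H : EuclideanSpace ℝ (Fin n) → ℝ)
    (u : EuclideanSpace ℝ (Fin n) → ℝ) (Ω : Set (EuclideanSpace ℝ (Fin n))) : Prop where
  continuousOn : ContinuousOn u Ω
  memSobolevLoc : MemSobolevLoc u Ω
  le_of_eq_boundary : ∀ V : Set (EuclideanSpace ℝ (Fin n)), IsOpen V → IsCompact (closure V) →
    closure V ⊆ Ω → ∀ v : EuclideanSpace ℝ (Fin n) → ℝ, MemSobolevLoc v V →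
      ContinuousOn v (closure V) → (∀ x ∈ frontier V, v x = u x) →
        supFunctional H u V ≤ supFunctional H v V

/-- `Su(x) = s`, where `Su(x) = lim_{r → 0+} ess sup_{B(x,r)} H(Du)`. (The limit always exists in
the extended reals for `u ∈ W^{1,∞}_loc`, by monotonicity in `r`.) -/
def HasSlope {n : ℕ} (H : EuclideanSpace ℝ (Fin n) → ℝ) (u : EuclideanSpace ℝ (Fin n) → ℝ)
    (x : EuclideanSpace ℝ (Fin n)) (s : EReal) : Prop :=
  Tendsto (fun r : ℝ => supFunctional H u (ball x r)) (𝓝[>] 0) (𝓝 s)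

/-- No level set of `H` contains a nondegenerate line segment. -/
def NoSegmentInLevelSets {n : ℕ} (H : EuclideanSpace ℝ (Fin n) → ℝ) : Prop :=
  ∀ c : ℝ, ∀ a b : EuclideanSpace ℝ (Fin n), a ≠ b → ¬ segment ℝ a b ⊆ H ⁻¹' {c}

/-- Linear growth at infinity. -/
def HasLinearGrowth {n : ℕ} (u : EuclideanSpace ℝ (Fin n) → ℝ) : Prop :=
  ∃ C : ℝ, 0 < C ∧ ∀ x, |u x| ≤ C * (1 + ‖x‖)

/-- The linear approximation property at infinity: every sequence `R_j → ∞` has a subsequence along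
which `y ↦ u(R_j y) / R_j` converges uniformly on the unit ball to a linear function
`y ↦ ⟨e, y⟩` with `H(e) = ess sup_{ℝⁿ} H(Du)`. -/
def HasLinearApproxAtInfinity {n : ℕ} (H : EuclideanSpace ℝ (Fin n) → ℝ)
    (u : EuclideanSpace ℝ (Fin n) → ℝ) : Prop :=
  ∀ R : ℕ → ℝ, Tendsto R atTop atTop →
    ∃ (k : ℕ → ℕ) (e : EuclideanSpace ℝ (Fin n)), StrictMono k ∧
      TendstoUniformlyOn (fun j y => u (R (k j) • y) / R (k j)) (fun y => inner ℝ e y) atTop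
        (ball 0 1) ∧
      (H e : EReal) = supFunctional H u univ

/-! Write `C_k` for the support function of the compact convex set `{H ≤ k}`. A bound `H(Du) ≤ k` on
an open set gives `u y - u x ≤ C_k (y - x)` along segments of that set, by mollification, and for
Lipschitz `u` such increments give back the gradient bound. So the `C_k` act as cones, and testing
an absolute minimizer against them gives comparison with cones from above
(`IsAbsoluteMinimizer.comparesWithConesAbove`); the same for `-u` and `p ↦ H (-p)` gives comparison
from below.

Let `K` be the total energy and `f` a limit of rescalings of `u`. If `f` lies strictly below the
cone of slope `K` at `0` on some sphere, compactness leaves room for a cone of slope `k < K` with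
any nearby vertex, and comparison gives `u` slope at most `k` on whole balls
(`ComparesWithConesAbove.exists_lt_of_forall_sphere_lt`). This is impossible if the slope `K` is
attained at the centre (B-1, no rescaling needed), or if the balls exhaust the space (B-2). Hence
`f` touches the cones on every sphere, from both sides.

Rigidity (`exists_affine_of_forall_touching`): going from the lower touching point `z` to the upper
one `y` uses up the whole cone bound, so one `p` in `{H ≤ K}` maximizes in both directions `y` and
`-z`. As the radius grows, the cones with vertices at the touching points flatten to linear
functions. By (A) maximizers are unique, so these functions all have slope `p`, and they squeeze `f`
onto an affine function. -/

/-! ### Support functions of compact sets. -/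

section SupportFunction

variable {E : Type*} [NormedAddCommGroup E] [InnerProductSpace ℝ E]

/-- The support function `w ↦ sup_{p ∈ S} ⟨p, w⟩` of a set `S`. -/
noncomputable def supportFn (S : Set E) (w : E) : ℝ :=
  sSup ((fun p => inner ℝ p w) '' S)

variable {S : Set E}

theorem inner_le_supportFn (hS : IsCompact S) {p : E} (hp : p ∈ S) (w : E) :
    inner ℝ p w ≤ supportFn S w :=
  le_csSup (hS.image (by fun_prop)).bddAbove (mem_image_of_mem _ hp)

theorem supportFn_le (hne : S.Nonempty) {w : E} {c : ℝ} (h : ∀ p ∈ S, inner ℝ p w ≤ c) :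
    supportFn S w ≤ c := by
  refine csSup_le (hne.image _) ?_
  rintro _ ⟨p, hp, rfl⟩
  exact h p hp

theorem exists_inner_eq_supportFn (hS : IsCompact S) (hne : S.Nonempty) (w : E) :
    ∃ p ∈ S, inner ℝ p w = supportFn S w := by
  have := (hS.image (f := fun p => inner ℝ p w) (by fun_prop)).sSup_mem (hne.image _)
  obtain ⟨p, hp, h⟩ := this
  exact ⟨p, hp, h⟩

theorem supportFn_zero (hne : S.Nonempty) : supportFn S (0 : E) = 0 := by
  simp [supportFn, hne]

theorem supportFn_add_le (hS : IsCompact S) (hne : S.Nonempty) (v w : E) :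
    supportFn S (v + w) ≤ supportFn S v + supportFn S w := by
  refine supportFn_le hne fun p hp => ?_
  rw [inner_add_right]
  exact add_le_add (inner_le_supportFn hS hp v) (inner_le_supportFn hS hp w)

theorem supportFn_smul (hS : IsCompact S) (hne : S.Nonempty) {c : ℝ} (hc : 0 ≤ c) (w : E) :
    supportFn S (c • w) = c * supportFn S w := by
  apply le_antisymm
  · refine supportFn_le hne fun p hp => ?_
    rw [real_inner_smul_right]
    exact mul_le_mul_of_nonneg_left (inner_le_supportFn hS hp w) hc
  · obtain ⟨p, hp, h⟩ := exists_inner_eq_supportFn hS hne w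
    rw [← h, ← real_inner_smul_right]
    exact inner_le_supportFn hS hp _

theorem supportFn_le_mul_norm (hne : S.Nonempty) {L : ℝ} (hL : ∀ p ∈ S, ‖p‖ ≤ L) (w : E) :
    supportFn S w ≤ L * ‖w‖ :=
  supportFn_le hne fun p hp => (real_inner_le_norm p w).trans
    (mul_le_mul_of_nonneg_right (hL p hp) (norm_nonneg w))

/-- A function with increments bounded by the support function of a bounded set is Lipschitz. -/
theorem lipschitzWith_of_sub_le_supportFn (hne : S.Nonempty) {L : NNReal}
    (hL : ∀ p ∈ S, ‖p‖ ≤ L) {f : E → ℝ} (hf : ∀ x y, f y - f x ≤ supportFn S (y - x)) :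
    LipschitzWith L f := by
  refine LipschitzWith.of_dist_le_mul fun x y => ?_
  have h1 := (hf x y).trans (supportFn_le_mul_norm hne hL _)
  have h2 := (hf y x).trans (supportFn_le_mul_norm hne hL _)
  rw [norm_sub_rev] at h1
  rw [Real.dist_eq, dist_eq_norm, abs_le]
  constructor <;> linarith

theorem supportFn_sub_le (hS : IsCompact S) (hne : S.Nonempty) (x y : E) :
    supportFn S y - supportFn S x ≤ supportFn S (y - x) := by
  have := supportFn_add_le hS hne (y - x) x
  rw [sub_add_cancel] at this
  linarith

omit [InnerProductSpace ℝ E] in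
theorem exists_norm_le_of_isCompact (hS : IsCompact S) : ∃ L : NNReal, ∀ p ∈ S, ‖p‖ ≤ L := by
  obtain ⟨L, hL⟩ := hS.isBounded.exists_norm_le
  exact ⟨L.toNNReal, fun p hp => (hL p hp).trans (Real.le_coe_toNNReal L)⟩

theorem continuous_supportFn (hS : IsCompact S) (hne : S.Nonempty) :
    Continuous (supportFn S) := by
  obtain ⟨L, hL⟩ := exists_norm_le_of_isCompact hS
  exact (lipschitzWith_of_sub_le_supportFn hne hL (supportFn_sub_le hS hne)).continuous

/-- A point dominated by the support function of a compact convex set belongs to the set. -/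
theorem mem_of_forall_inner_le_supportFn [CompleteSpace E] (hS : IsCompact S)
    (hne : S.Nonempty) (hconv : Convex ℝ S) {g : E} (h : ∀ w, inner ℝ g w ≤ supportFn S w) :
    g ∈ S := by
  by_contra hg
  obtain ⟨f, c, hlt, hgt⟩ := geometric_hahn_banach_closed_point hconv hS.isClosed hg
  set w := (InnerProductSpace.toDual ℝ E).symm f
  have hw : ∀ p, f p = inner ℝ p w := fun p => by
    rw [real_inner_comm, InnerProductSpace.toDual_symm_apply]
  have h1 : supportFn S w ≤ c := supportFn_le hne fun p hp => (hw p) ▸ (hlt p hp).le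
  have h2 := h w
  rw [← hw] at h2
  linarith

/-- Translates the cones of the reflected Hamiltonian `p ↦ H (-p)` into those of `H`. -/
theorem supportFn_neg_preimage (S : Set E) (w : E) :
    supportFn {p | -p ∈ S} w = supportFn S (-w) := by
  unfold supportFn
  congr 1
  ext c
  constructor
  · rintro ⟨p, hp, rfl⟩
    exact ⟨-p, hp, by simp⟩
  · rintro ⟨p, hp, rfl⟩
    exact ⟨-p, by simpa using hp, by simp⟩

end SupportFunction

/-! ### Sublevel sets of a coercive Hamiltonian and their support functions. -/

section Sublevel

variable {E : Type*} [NormedAddCommGroup E] [InnerProductSpace ℝ E]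
variable {H : E → ℝ}

omit [InnerProductSpace ℝ E] in
theorem isCompact_sublevel [ProperSpace E] (hcont : Continuous H)
    (hcoer : Tendsto H (Bornology.cobounded E) atTop) (k : ℝ) : IsCompact {p | H p ≤ k} := by
  refine Metric.isCompact_of_isClosed_isBounded (isClosed_le hcont continuous_const) ?_
  have h := hcoer.eventually (eventually_gt_atTop k)
  rw [← Bornology.isCobounded_compl_iff]
  filter_upwards [h] with p hp
  simpa using hp

/-- A maximizer of a nonzero linear functional over a sublevel set lies on the level set. -/
theorem eq_of_inner_eq_supportFn [ProperSpace E] (hcont : Continuous H)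
    (hcoer : Tendsto H (Bornology.cobounded E) atTop) {k : ℝ} {p w : E} (hw : w ≠ 0)
    (hp : H p ≤ k) (hmax : inner ℝ p w = supportFn {q | H q ≤ k} w) : H p = k := by
  by_contra hne
  have hlt : H p < k := lt_of_le_of_ne hp hne
  have hlim : Tendsto (fun t : ℝ => H (p + t • w)) (𝓝[>] 0) (𝓝 (H p)) := by
    have : Continuous fun t : ℝ => H (p + t • w) := by fun_prop
    simpa using (this.tendsto 0).mono_left nhdsWithin_le_nhds
  -- If `H p < k`, a small move along `w` stays in the sublevel set and increases the functional.
  obtain ⟨t, ht, ht0⟩ := ((hlim.eventually (eventually_lt_nhds hlt)).and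
    self_mem_nhdsWithin).exists
  have h := inner_le_supportFn (isCompact_sublevel hcont hcoer k)
    (show p + t • w ∈ {q | H q ≤ k} from ht.le) w
  rw [← hmax, inner_add_left, real_inner_smul_left, real_inner_self_eq_norm_sq] at h
  have : 0 < t * ‖w‖ ^ 2 := mul_pos ht0 (by positivity)
  linarith

/-- If the level sets contain no segment, maximizers over a sublevel set are unique. -/
theorem eq_of_inner_eq_supportFn_of_forall_segment [ProperSpace E] (hcont : Continuous H)
    (hconv : ConvexOn ℝ univ H) (hcoer : Tendsto H (Bornology.cobounded E) atTop)
    (hA : ∀ c : ℝ, ∀ a b : E, a ≠ b → ¬ segment ℝ a b ⊆ H ⁻¹' {c}) {k : ℝ} {p q w : E}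
    (hw : w ≠ 0) (hp : H p ≤ k) (hq : H q ≤ k)
    (hpm : inner ℝ p w = supportFn {r | H r ≤ k} w)
    (hqm : inner ℝ q w = supportFn {r | H r ≤ k} w) : p = q := by
  by_contra hne
  refine hA k p q hne ?_
  rintro _ ⟨a, b, ha, hb, hab, rfl⟩
  -- Every point between two maximizers is again a maximizer, so the whole segment lies on level
  -- `k`.
  refine eq_of_inner_eq_supportFn hcont hcoer hw ?_ ?_
  · have := hconv.convex_le k
    exact (this (x := p) (by simpa using hp) (y := q) (by simpa using hq) ha hb hab).2
  · rw [inner_add_left, real_inner_smul_left, real_inner_smul_left, hpm, hqm, ← add_mul, hab,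
      one_mul]

/-- The support functions of the sublevel sets depend continuously from below on the level. -/
theorem exists_lt_supportFn_sublevel_ge [ProperSpace E] (hcont : Continuous H)
    (hconv : ConvexOn ℝ univ H) (hcoer : Tendsto H (Bornology.cobounded E) atTop) {p₀ : E}
    {K ε r : ℝ} (hp₀ : H p₀ < K) (hε : 0 < ε) :
    ∃ k < K, H p₀ ≤ k ∧ ∀ w, ‖w‖ ≤ r →
      supportFn {p | H p ≤ K} w - ε ≤ supportFn {p | H p ≤ k} w := by
  have hSK := isCompact_sublevel hcont hcoer K
  have hneK : {p | H p ≤ K}.Nonempty := ⟨p₀, hp₀.le⟩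
  have hbdd : ∃ M, ∀ w : E, ‖w‖ ≤ r → supportFn {p | H p ≤ K} w - inner ℝ p₀ w ≤ M := by
    have hc : Continuous fun w => supportFn {p | H p ≤ K} w - inner ℝ p₀ w :=
      (continuous_supportFn hSK hneK).sub (by fun_prop)
    obtain ⟨M, hM⟩ := ((isCompact_closedBall (0 : E) r).image hc).bddAbove
    exact ⟨M, fun w hw => hM ⟨w, by simpa using hw, rfl⟩⟩
  obtain ⟨M, hM⟩ := hbdd
  obtain ⟨t, ht0, ht1, htM⟩ : ∃ t : ℝ, 0 < t ∧ t ≤ 1 ∧ t * M ≤ ε := by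
    refine ⟨min 1 (ε / (|M| + 1)), by positivity, min_le_left _ _, ?_⟩
    have h0 : (0 : ℝ) ≤ min 1 (ε / (|M| + 1)) := by positivity
    have hM1 : M ≤ |M| + 1 := by linarith [le_abs_self M]
    calc min 1 (ε / (|M| + 1)) * M ≤ min 1 (ε / (|M| + 1)) * (|M| + 1) :=
          mul_le_mul_of_nonneg_left hM1 h0
      _ ≤ ε / (|M| + 1) * (|M| + 1) :=
          mul_le_mul_of_nonneg_right (min_le_right _ _) (by positivity)
      _ = ε := by field_simp
  -- Pulling a maximizer for `K` towards `p₀` by the fraction `t` lowers `H` to this level by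
  -- convexity, and costs at most `t * M ≤ ε` in direction `w`.
  refine ⟨(1 - t) * K + t * H p₀, by nlinarith, by nlinarith, fun w hw => ?_⟩
  obtain ⟨p, hp, hpw⟩ := exists_inner_eq_supportFn hSK hneK w
  have hmem : (1 - t) • p + t • p₀ ∈ {q | H q ≤ (1 - t) * K + t * H p₀} := by
    have := hconv.2 (mem_univ p) (mem_univ p₀) (sub_nonneg.2 ht1) ht0.le (by ring)
    simp only [smul_eq_mul] at this
    have h2 : (1 - t) * H p ≤ (1 - t) * K := mul_le_mul_of_nonneg_left hp (by linarith)
    show H _ ≤ _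
    linarith
  have h := inner_le_supportFn (isCompact_sublevel hcont hcoer _) hmem w
  rw [inner_add_left, real_inner_smul_left, real_inner_smul_left, hpw] at h
  have h3 := mul_le_mul_of_nonneg_left (hM w hw) ht0.le
  nlinarith

/-- The sublevel sets of a continuous function eventually contain any given ball. -/
theorem exists_mul_norm_le_supportFn_sublevel [ProperSpace E] (hcont : Continuous H)
    (hcoer : Tendsto H (Bornology.cobounded E) atTop) {m : ℝ} (hm : 0 ≤ m) :
    ∃ k, {p | H p ≤ k}.Nonempty ∧ ∀ w, m * ‖w‖ ≤ supportFn {p | H p ≤ k} w := by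
  obtain ⟨k, hk⟩ := ((isCompact_closedBall (0 : E) m).image hcont).bddAbove
  have hsub : ∀ p : E, ‖p‖ ≤ m → H p ≤ k := fun p hp => hk ⟨p, by simpa using hp, rfl⟩
  refine ⟨k, ⟨0, hsub 0 (by simpa using hm)⟩, fun w => ?_⟩
  rcases eq_or_ne w 0 with rfl | hw
  · rw [supportFn_zero ⟨0, hsub 0 (by simpa using hm)⟩]
    simp
  have hw' : ‖w‖ ≠ 0 := norm_ne_zero_iff.2 hw
  have h := inner_le_supportFn (isCompact_sublevel hcont hcoer k)
    (show (m / ‖w‖) • w ∈ {p | H p ≤ k} from hsub _ (by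
      rw [norm_smul, Real.norm_of_nonneg (by positivity), div_mul_cancel₀ _ hw'])) w
  rw [real_inner_smul_left, real_inner_self_eq_norm_sq] at h
  calc m * ‖w‖ = m / ‖w‖ * ‖w‖ ^ 2 := by field_simp
    _ ≤ _ := h

end Sublevel

/-! ### Weak gradients: restriction, uniqueness, Lipschitz functions. -/

section WeakGradient

variable {n : ℕ} {u : EuclideanSpace ℝ (Fin n) → ℝ}
  {g g' : EuclideanSpace ℝ (Fin n) → EuclideanSpace ℝ (Fin n)}
  {U V : Set (EuclideanSpace ℝ (Fin n))}

theorem setIntegral_eq_of_tsupport_subset {F f : EuclideanSpace ℝ (Fin n) → ℝ}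
    (hF : tsupport f ⊆ U) (h : ∀ x, f x = 0 → F x = 0) : ∫ x in U, F x = ∫ x, F x := by
  refine setIntegral_eq_integral_of_forall_compl_eq_zero fun x hx => h x ?_
  exact image_eq_zero_of_notMem_tsupport fun hx' => hx (hF hx')

theorem setIntegral_mul_fderiv_eq {φ : EuclideanSpace ℝ (Fin n) → ℝ} (hφ : tsupport φ ⊆ U)
    (w : EuclideanSpace ℝ (Fin n)) :
    ∫ x in U, u x * fderiv ℝ φ x w = ∫ x, u x * fderiv ℝ φ x w := by
  refine setIntegral_eq_of_tsupport_subset (f := fun x => fderiv ℝ φ x w)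
    ((tsupport_fderiv_apply_subset ℝ w).trans hφ) fun x hx => by simp [hx]

theorem setIntegral_mul_inner_eq {φ : EuclideanSpace ℝ (Fin n) → ℝ} (hφ : tsupport φ ⊆ U)
    (w : EuclideanSpace ℝ (Fin n)) :
    ∫ x in U, φ x * inner ℝ (g x) w = ∫ x, φ x * inner ℝ (g x) w :=
  setIntegral_eq_of_tsupport_subset hφ fun x hx => by simp [hx]

theorem HasWeakGradOn.mono (h : HasWeakGradOn u g U) (hVU : V ⊆ U) : HasWeakGradOn u g V where
  locallyIntegrableOn_fun := h.locallyIntegrableOn_fun.mono_set hVU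
  locallyIntegrableOn_grad := h.locallyIntegrableOn_grad.mono_set hVU
  integral_eq φ hφ hc hs w := by
    have := h.integral_eq φ hφ hc (hs.trans hVU) w
    rw [setIntegral_mul_fderiv_eq hs, setIntegral_mul_inner_eq hs]
    rwa [setIntegral_mul_fderiv_eq (hs.trans hVU), setIntegral_mul_inner_eq (hs.trans hVU)] at this

theorem HasWeakGradOn.neg (h : HasWeakGradOn u g U) :
    HasWeakGradOn (fun x => -u x) (fun x => -g x) U where
  locallyIntegrableOn_fun := h.locallyIntegrableOn_fun.neg
  locallyIntegrableOn_grad := h.locallyIntegrableOn_grad.neg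
  integral_eq φ hφ hc hs w := by
    have := h.integral_eq φ hφ hc hs w
    simp only [neg_mul, inner_neg_left, mul_neg, integral_neg, this]

/-- The fundamental lemma of the calculus of variations, tested componentwise. Since `weakGrad` is
an arbitrary choice, every computation of it rests on this uniqueness. -/
theorem HasWeakGradOn.ae_eq (hU : IsOpen U) (h : HasWeakGradOn u g U)
    (h' : HasWeakGradOn u g' U) : ∀ᵐ x ∂volume.restrict U, g x = g' x := by
  rw [ae_restrict_iff' hU.measurableSet]
  have hloc : LocallyIntegrableOn (fun x => g x - g' x) U volume :=
    h.locallyIntegrableOn_grad.sub h'.locallyIntegrableOn_grad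
  have hint : ∀ {f : EuclideanSpace ℝ (Fin n) → EuclideanSpace ℝ (Fin n)},
      LocallyIntegrableOn f U volume → ∀ φ : EuclideanSpace ℝ (Fin n) → ℝ, ContDiff ℝ ∞ φ →
      HasCompactSupport φ → tsupport φ ⊆ U → Integrable (fun x => φ x • f x) volume := by
    intro f hf φ hφ hc hs
    have h1 : IntegrableOn (fun x => φ x • f x) (tsupport φ) volume :=
      (hf.integrableOn_compact_subset hs hc).continuousOn_smul hφ.continuous.continuousOn hc
    refine (integrableOn_iff_integrable_of_support_subset ?_).1 h1
    exact (Function.support_smul_subset_left _ _).trans (subset_tsupport φ)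
  have key := hU.ae_eq_zero_of_integral_contDiff_smul_eq_zero hloc fun φ hφ hc hs => by
    have hi := hint hloc φ hφ hc hs
    refine ext_inner_right ℝ fun w => ?_
    have e := (h.integral_eq φ hφ hc hs w).symm.trans (h'.integral_eq φ hφ hc hs w)
    rw [neg_inj, setIntegral_mul_inner_eq hs, setIntegral_mul_inner_eq hs] at e
    have hi1 := (hint h.locallyIntegrableOn_grad φ hφ hc hs).inner_const (𝕜 := ℝ) w
    have hi2 := (hint h'.locallyIntegrableOn_grad φ hφ hc hs).inner_const (𝕜 := ℝ) w
    simp only [real_inner_smul_left] at hi1 hi2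
    rw [inner_zero_left, real_inner_comm, ← integral_inner hi]
    simp only [real_inner_comm _ w, real_inner_smul_left, inner_sub_left, mul_sub]
    rw [integral_sub hi1 hi2, e, sub_self]
  filter_upwards [key] with x hx hxU
  exact sub_eq_zero.1 (hx hxU)

theorem HasWeakGradOn.weakGrad (h : HasWeakGradOn u g U) :
    HasWeakGradOn u (weakGrad u U) U := by
  have hex : ∃ g, HasWeakGradOn u g U := ⟨g, h⟩
  unfold _root_.weakGrad
  rw [dif_pos hex]
  exact hex.choose_spec

theorem hasWeakGradOn_weakGrad (h : MemSobolevLoc u U) : HasWeakGradOn u (weakGrad u U) U :=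
  h.choose_spec.1.weakGrad

theorem MemSobolevLoc.mono (h : MemSobolevLoc u U) (hVU : V ⊆ U) : MemSobolevLoc u V := by
  obtain ⟨g, hg, hb⟩ := h
  exact ⟨g, hg.mono hVU, fun K hK hKV => hb K hK (hKV.trans hVU)⟩

theorem MemSobolevLoc.neg (h : MemSobolevLoc u U) : MemSobolevLoc (fun x => -u x) U := by
  obtain ⟨g, hg, hb⟩ := h
  exact ⟨_, hg.neg, fun K hK hKU => ⟨(hb K hK hKU).1.neg, (hb K hK hKU).2.neg⟩⟩

theorem HasWeakGradOn.ae_weakGrad_eq (hU : IsOpen U) (h : HasWeakGradOn u g U) :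
    ∀ᵐ x ∂volume.restrict U, _root_.weakGrad u U x = g x :=
  h.weakGrad.ae_eq hU h

/-- The weak gradient of a Lipschitz function is its pointwise gradient. -/
theorem LipschitzWith.hasWeakGradOn_gradient {L : NNReal} (hu : LipschitzWith L u) :
    HasWeakGradOn u (gradient u) univ where
  locallyIntegrableOn_fun := hu.continuous.locallyIntegrable.locallyIntegrableOn _
  locallyIntegrableOn_grad := by
    have hm : Measurable (gradient u) :=
      (InnerProductSpace.toDual ℝ _).symm.continuous.measurable.comp (measurable_fderiv ℝ u)
    refine ((memLp_top_of_bound hm.aestronglyMeasurable L (.of_forall fun x => ?_)).locallyIntegrable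
      le_top).locallyIntegrableOn _
    simpa [gradient] using norm_fderiv_le_of_lipschitz ℝ hu
  integral_eq φ hφ hc _ w := by
    obtain ⟨D, hD⟩ := hφ.lipschitzWith_of_hasCompactSupport hc (by simp)
    have h := hu.integral_lineDeriv_mul_eq (μ := volume) hD hc w
    simp only [Measure.restrict_univ, inner_gradient_left]
    have h1 : ∫ x, lineDeriv ℝ u x w * φ x = ∫ x, φ x * fderiv ℝ u x w := by
      refine integral_congr_ae ?_
      filter_upwards [hu.ae_differentiableAt (μ := volume)] with x hx
      rw [hx.lineDeriv_eq_fderiv, mul_comm]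
    have h2 : ∫ x, lineDeriv ℝ φ x (-w) * u x = -∫ x, u x * fderiv ℝ φ x w := by
      rw [← integral_neg]
      congr 1
      ext x
      rw [(hφ.differentiable (by simp) x).lineDeriv_eq_fderiv]
      simp [mul_comm]
    rw [← h1, h, h2, neg_neg]

theorem LipschitzWith.memSobolevLoc {L : NNReal} (hu : LipschitzWith L u) :
    MemSobolevLoc u univ := by
  have hm : Measurable (gradient u) :=
    (InnerProductSpace.toDual ℝ _).symm.continuous.measurable.comp (measurable_fderiv ℝ u)
  refine ⟨_, hu.hasWeakGradOn_gradient, fun K hK _ => ⟨?_, ?_⟩⟩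
  · obtain ⟨C, hC⟩ := hK.exists_bound_of_continuousOn hu.continuous.continuousOn
    exact memLp_top_of_bound hu.continuous.aestronglyMeasurable C
      ((ae_restrict_iff' hK.measurableSet).2 (.of_forall hC))
  · refine memLp_top_of_bound hm.aestronglyMeasurable L (.of_forall fun x => ?_)
    simpa [gradient] using norm_fderiv_le_of_lipschitz ℝ hu

end WeakGradient

/-! ### Gradient bounds versus increment bounds. -/

section SupFunctional

variable {n : ℕ} {H : EuclideanSpace ℝ (Fin n) → ℝ} {u : EuclideanSpace ℝ (Fin n) → ℝ}
  {U : Set (EuclideanSpace ℝ (Fin n))}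

theorem ae_le_of_supFunctional_le {k : ℝ} (h : supFunctional H u U ≤ k) :
    ∀ᵐ x ∂volume.restrict U, H (weakGrad u U x) ≤ k := by
  filter_upwards [ae_le_essSup (f := fun x => (H (weakGrad u U x) : EReal))
    (μ := volume.restrict U)] with x hx
  exact EReal.coe_le_coe_iff.1 (hx.trans h)

theorem supFunctional_neg (hU : IsOpen U) (h : MemSobolevLoc u U) :
    supFunctional (fun p => H (-p)) (fun x => -u x) U = supFunctional H u U := by
  refine essSup_congr_ae ?_
  filter_upwards [(hasWeakGradOn_weakGrad h).neg.ae_weakGrad_eq hU] with x hx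
  simp [hx]

/-- A function whose increments on an open set are bounded by the support function of a sublevel
set of `H` satisfies the corresponding gradient bound. -/
theorem supFunctional_le_of_forall_sub_le (hcont : Continuous H) (hconv : ConvexOn ℝ univ H)
    (hcoer : Tendsto H (Bornology.cobounded (EuclideanSpace ℝ (Fin n))) atTop) {k : ℝ}
    (hne : {p | H p ≤ k}.Nonempty) {L : NNReal} (hL : LipschitzWith L u) (hU : IsOpen U)
    (hu : ∀ x ∈ U, ∀ y ∈ U, u y - u x ≤ supportFn {p | H p ≤ k} (y - x)) :
    supFunctional H u U ≤ k := by
  have hS := isCompact_sublevel hcont hcoer k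
  have hc : Convex ℝ {p | H p ≤ k} := by simpa using hconv.convex_le k
  refine essSup_le_of_ae_le _ ?_
  filter_upwards [(hL.hasWeakGradOn_gradient.mono (subset_univ U)).ae_weakGrad_eq hU,
    ae_restrict_mem hU.measurableSet,
    ae_restrict_of_ae (hL.ae_differentiableAt (μ := volume))] with x hx hxU hd
  rw [hx, EReal.coe_le_coe_iff]
  refine mem_of_forall_inner_le_supportFn hS hne hc fun w => ?_
  rw [inner_gradient_left]
  -- Homogeneity of the support function bounds each one-sided difference quotient in direction `w`.
  have hlim := (hd.hasFDerivAt.hasLineDerivAt w).tendsto_slope_zero_right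
  refine le_of_tendsto hlim ?_
  have hmem : ∀ᶠ t : ℝ in 𝓝[>] 0, x + t • w ∈ U := by
    have hcl : Continuous fun t : ℝ => x + t • w := by fun_prop
    have : ∀ᶠ t : ℝ in 𝓝 0, x + t • w ∈ U :=
      hcl.continuousAt.eventually (hU.mem_nhds (by simpa using hxU))
    exact this.filter_mono nhdsWithin_le_nhds
  filter_upwards [hmem, self_mem_nhdsWithin] with t ht ht0
  have ht0' : 0 < t := ht0
  have h1 := hu x hxU _ ht
  rw [add_sub_cancel_left, supportFn_smul hS hne ht0'.le] at h1
  rw [smul_eq_mul]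
  rw [inv_mul_le_iff₀ ht0']
  exact h1

/-- A gradient bound on an open set bounds the increments along segments in that set. -/
theorem sub_le_supportFn_of_supFunctional_le (hcont : Continuous H)
    (hcoer : Tendsto H (Bornology.cobounded (EuclideanSpace ℝ (Fin n))) atTop) {k : ℝ}
    (hu : Continuous u) (hU : IsOpen U) (hs : MemSobolevLoc u U) (hk : supFunctional H u U ≤ k)
    {x y : EuclideanSpace ℝ (Fin n)} (hxy : segment ℝ x y ⊆ U) :
    u y - u x ≤ supportFn {p | H p ≤ k} (y - x) := by
  have hS := isCompact_sublevel hcont hcoer k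
  set C := supportFn {p | H p ≤ k} (y - x) with hC
  by_contra! hlt
  have hseg : IsCompact (segment ℝ x y) := by
    rw [segment_eq_image_lineMap]
    exact isCompact_Icc.image AffineMap.lineMap_continuous
  obtain ⟨δ, hδ, hδU⟩ := hseg.exists_cthickening_subset_open hU hxy
  -- near the endpoints the increment still exceeds `C`
  have hnear : ∀ᶠ z in 𝓝 (0 : EuclideanSpace ℝ (Fin n)), C < u (y - z) - u (x - z) := by
    have hcz : Continuous fun z => u (y - z) - u (x - z) := by fun_prop
    exact hcz.continuousAt.eventually (lt_mem_nhds (by simpa using hlt))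
  obtain ⟨ε, hε, hεC⟩ := Metric.eventually_nhds_iff_ball.1 hnear
  -- `δ` keeps the translated bumps inside `U`; `ε` lets the strict inequality survive averaging.
  -- The bump is not normalized, hence the factors `∫ t, φ t` below.
  set r := min δ ε with hr
  have hr0 : 0 < r := lt_min hδ hε
  let φ : ContDiffBump (0 : EuclideanSpace ℝ (Fin n)) := ⟨r / 2, r, by positivity, by linarith⟩
  have hφc : HasCompactSupport φ := φ.hasCompactSupport
  have hφs : ContDiff ℝ ∞ φ := φ.contDiff
  have hloc : LocallyIntegrable u volume := hu.locallyIntegrable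
  let M : EuclideanSpace ℝ (Fin n) → ℝ :=
    MeasureTheory.convolution u φ (ContinuousLinearMap.mul ℝ ℝ) volume
  have hM : ∀ z, HasFDerivAt M _ z := fun z =>
    hφc.hasFDerivAt_convolution_right (ContinuousLinearMap.mul ℝ ℝ) hloc (hφs.of_le (by simp)) z
  have hg := hasWeakGradOn_weakGrad hs
  have hle := ae_le_of_supFunctional_le hk
  -- the derivative of the mollification in direction `y - x`
  have hderiv : ∀ z ∈ segment ℝ x y, fderiv ℝ M z (y - x) ≤ C * ∫ t, φ t := by
    intro z hz
    rw [(hM z).fderiv, convolution_precompR_apply _ hloc (hφc.fderiv ℝ)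
      (hφs.continuous_fderiv (by simp)), convolution_def]
    let ψ : EuclideanSpace ℝ (Fin n) → ℝ := fun t => φ (z - t)
    have hψs : ContDiff ℝ ∞ ψ := hφs.comp (contDiff_const.sub contDiff_id)
    have hψsupp : tsupport ψ ⊆ closedBall z r := by
      refine closure_minimal (fun t ht => ?_) isClosed_closedBall
      have : z - t ∈ Function.support φ := ht
      rw [φ.support_eq] at this
      rw [mem_closedBall, dist_comm, dist_eq_norm]
      simpa using (mem_ball_zero_iff.1 this).le
    have hψc : HasCompactSupport ψ :=
      HasCompactSupport.of_support_subset_isCompact (isCompact_closedBall z r)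
        ((subset_tsupport ψ).trans hψsupp)
    have hψU : tsupport ψ ⊆ U := by
      refine hψsupp.trans (Subset.trans ?_ hδU)
      exact (closedBall_subset_closedBall (min_le_left _ _)).trans
        (closedBall_subset_cthickening hz δ)
    -- Testing with the reflected bump moves the derivative of the mollification onto the weak
    -- gradient.
    have hw := hg.integral_eq ψ hψs hψc hψU (y - x)
    have hfd : ∀ t, fderiv ℝ ψ t (y - x) = -fderiv ℝ φ (z - t) (y - x) := fun t => by
      have h1 : HasFDerivAt ψ ((fderiv ℝ φ (z - t)).comp
          (-(ContinuousLinearMap.id ℝ (EuclideanSpace ℝ (Fin n))))) t :=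
        ((hφs.differentiable (by simp) (z - t)).hasFDerivAt).comp t
          ((hasFDerivAt_id t).const_sub z)
      rw [h1.fderiv]
      simp
    rw [setIntegral_mul_fderiv_eq hψU] at hw
    simp only [hfd, mul_neg, integral_neg, neg_inj] at hw
    simp only [ContinuousLinearMap.mul_apply']
    rw [hw]
    have hψi : Integrable ψ volume := hψs.continuous.integrable_of_hasCompactSupport hψc
    have h2 : ∫ t in U, ψ t * inner ℝ (weakGrad u U t) (y - x) ≤ ∫ t in U, ψ t * C := by
      obtain ⟨B, hB⟩ := exists_norm_le_of_isCompact hS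
      refine integral_mono_ae ?_ (hψi.mul_const C).integrableOn ?_
      · refine (hψi.integrableOn (s := U)).mul_bdd (c := B * ‖y - x‖) ?_ ?_
        · exact hg.locallyIntegrableOn_grad.aestronglyMeasurable.inner_const
        · filter_upwards [hle] with t ht
          exact (norm_inner_le_norm _ _).trans (by gcongr; exact hB _ ht)
      · filter_upwards [hle] with t ht
        exact mul_le_mul_of_nonneg_left (inner_le_supportFn hS ht _) φ.nonneg
    have h3 : ∫ t in U, ψ t * C = C * ∫ t, φ t := by
      rw [setIntegral_eq_of_tsupport_subset hψU fun t ht => by simp [ht], integral_mul_const,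
        mul_comm]
      congr 1
      exact integral_sub_left_eq_self (fun t => φ t) volume z
    exact h2.trans_eq h3
  have hMVT : M y - M x ≤ C * ∫ t, φ t := by
    have hmd : ∀ t : ℝ, HasDerivAt (fun t : ℝ => M (AffineMap.lineMap x y t))
        (fderiv ℝ M (AffineMap.lineMap x y t) (y - x)) t := fun t =>
      ((hM _).differentiableAt.hasFDerivAt).comp_hasDerivAt t AffineMap.hasDerivAt_lineMap
    have := (convex_Icc (0 : ℝ) 1).image_sub_le_mul_sub_of_deriv_le
      (f := fun t : ℝ => M (AffineMap.lineMap x y t)) (C := C * ∫ t, φ t)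
      (fun t _ => (hmd t).continuousAt.continuousWithinAt)
      (fun t _ => (hmd t).differentiableAt.differentiableWithinAt)
      (fun t ht => by
        rw [(hmd t).deriv]
        refine hderiv _ ?_
        rw [segment_eq_image_lineMap]
        exact mem_image_of_mem _ (interior_subset ht))
      0 (by simp) 1 (by simp) zero_le_one
    simpa using this
  have hMeq : ∀ z, M z = ∫ t, u (z - t) * φ t := fun z => by
    simp only [M, convolution_eq_swap, ContinuousLinearMap.mul_apply']
  have hi : ∀ z, Integrable (fun t => u (z - t) * φ t) volume := fun z =>
    (by fun_prop : Continuous fun t => u (z - t) * φ t).integrable_of_hasCompactSupport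
      hφc.mul_left
  have hφi : Integrable (fun t => φ t) volume := φ.continuous.integrable_of_hasCompactSupport hφc
  have hpos : 0 < ∫ t, (u (y - t) - u (x - t) - C) * φ t := by
    have hcF : Continuous fun t => (u (y - t) - u (x - t) - C) * φ t := by fun_prop
    refine hcF.integral_pos_of_hasCompactSupport_nonneg_nonzero hφc.mul_left (fun t => ?_)
      (x := 0) ?_
    · by_cases ht : t ∈ ball (0 : EuclideanSpace ℝ (Fin n)) r
      · have := hεC t (ball_subset_ball (min_le_right _ _) ht)
        exact mul_nonneg (by linarith) φ.nonneg
      · rw [φ.zero_of_le_dist (by simpa using ht), mul_zero]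
        rfl
    · have := hεC 0 (mem_ball_self hε)
      rw [φ.one_of_mem_closedBall (mem_closedBall_self (by positivity)), mul_one]
      exact (sub_pos.2 this).ne'
  have hexp : ∫ t, (u (y - t) - u (x - t) - C) * φ t = M y - M x - C * ∫ t, φ t := by
    simp only [sub_mul]
    have hyx : Integrable (fun t => u (y - t) * φ t - u (x - t) * φ t) volume :=
      (hi y).sub (hi x)
    rw [integral_sub hyx (hφi.const_mul C), integral_sub (hi y) (hi x),
      integral_const_mul, hMeq, hMeq]
  linarith

end SupFunctional

/-- Comparison with cones from above on balls, the cones being the support functions of the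
sublevel sets of `H`. -/
def ComparesWithConesAbove {E : Type*} [NormedAddCommGroup E] [InnerProductSpace ℝ E]
    (H u : E → ℝ) : Prop :=
  ∀ k : ℝ, {p | H p ≤ k}.Nonempty → ∀ (c : E) (r : ℝ) (x : E), x ∈ ball c r →
    (∀ y ∈ sphere c r, u y ≤ u x + supportFn {p | H p ≤ k} (y - x)) →
      ∀ y ∈ ball c r, u y ≤ u x + supportFn {p | H p ≤ k} (y - x)

/-! ### Absolute minimizers and comparison with cones. -/

section AbsoluteMinimizer

variable {n : ℕ} {H : EuclideanSpace ℝ (Fin n) → ℝ} {u : EuclideanSpace ℝ (Fin n) → ℝ}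

theorem IsAbsoluteMinimizer.continuous (h : IsAbsoluteMinimizer H u univ) : Continuous u :=
  continuousOn_univ.1 h.continuousOn

theorem IsAbsoluteMinimizer.neg (h : IsAbsoluteMinimizer H u univ) :
    IsAbsoluteMinimizer (fun p => H (-p)) (fun x => -u x) univ where
  continuousOn := h.continuousOn.neg
  memSobolevLoc := h.memSobolevLoc.neg
  le_of_eq_boundary V hV hc hs v hv hvc hb := by
    rw [supFunctional_neg hV (h.memSobolevLoc.mono (subset_univ V))]
    have h1 := h.le_of_eq_boundary V hV hc hs (fun x => -v x) hv.neg hvc.neg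
      (fun x hx => by rw [hb x hx, neg_neg])
    have h2 := supFunctional_neg (H := H) hV hv.neg
    simp only [neg_neg] at h2
    rwa [h2]

/-- On the set `W` where `u` exceeds the cone `v`, `v` is a competitor, so `H(Du) ≤ k` there. Then
`u` grows along a ray from the vertex no faster than the cone while in `W`, and cannot end up above
it. -/
theorem IsAbsoluteMinimizer.comparesWithConesAbove (hcont : Continuous H)
    (hconv : ConvexOn ℝ univ H)
    (hcoer : Tendsto H (Bornology.cobounded (EuclideanSpace ℝ (Fin n))) atTop)
    (h : IsAbsoluteMinimizer H u univ) : ComparesWithConesAbove H u := by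
  intro k hne c r x hx hsph y hy
  have hS := isCompact_sublevel hcont hcoer k
  have hu := h.continuous
  set C := supportFn {p | H p ≤ k} with hC
  have hCc : Continuous C := continuous_supportFn hS hne
  obtain ⟨L, hL⟩ := exists_norm_le_of_isCompact hS
  set v : EuclideanSpace ℝ (Fin n) → ℝ := fun y => u x + C (y - x) with hv
  have hvc : Continuous v := by fun_prop
  have hvC : ∀ a b, v b - v a ≤ C (b - a) := fun a b => by
    have := supportFn_sub_le hS hne (a - x) (b - x)
    rw [sub_sub_sub_cancel_right] at this
    simp only [hv]
    linarith
  have hvL : LipschitzWith L v := lipschitzWith_of_sub_le_supportFn hne hL hvC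
  set W := {y | y ∈ ball c r ∧ v y < u y} with hW
  have hWo : IsOpen W := isOpen_ball.inter (isOpen_lt hvc hu)
  have hWcl : closure W ⊆ closedBall c r ∩ {y | v y ≤ u y} :=
    closure_minimal (fun z hz => ⟨ball_subset_closedBall hz.1, hz.2.le⟩)
      (isClosed_closedBall.inter (isClosed_le hvc hu))
  have hWc : IsCompact (closure W) :=
    (isCompact_closedBall c r).of_isClosed_subset isClosed_closure
      (hWcl.trans inter_subset_left)
  have hbd : ∀ z ∈ frontier W, v z = u z := by
    intro z hz
    rw [hWo.frontier_eq] at hz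
    obtain ⟨h1, h2⟩ := hWcl hz.1
    refine le_antisymm h2 ?_
    rcases (mem_closedBall.1 h1).lt_or_eq with hlt | heq
    · exact not_lt.1 fun hlt' => hz.2 ⟨mem_ball.2 hlt, hlt'⟩
    · exact hsph z (mem_sphere.2 heq)
  have hle : supFunctional H u W ≤ k :=
    (h.le_of_eq_boundary W hWo hWc (subset_univ _) v (hvL.memSobolevLoc.mono (subset_univ _))
      hvc.continuousOn hbd).trans
      (supFunctional_le_of_forall_sub_le hcont hconv hcoer hne hvL hWo fun a _ b _ => hvC a b)
  by_contra! hlt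
  set γ : ℝ → EuclideanSpace ℝ (Fin n) := fun t => x + t • (y - x) with hγ
  have hγc : Continuous γ := by fun_prop
  have hγ1 : γ 1 = y := by simp [hγ]
  have hγball : ∀ t ∈ Icc (0 : ℝ) 1, γ t ∈ ball c r := fun t ht =>
    (convex_ball c r).add_smul_sub_mem hx hy ht
  have hTc : IsCompact (Icc (0 : ℝ) 1 ∩ γ ⁻¹' Wᶜ) :=
    isCompact_Icc.inter_right (hWo.isClosed_compl.preimage hγc)
  have hTne : (Icc (0 : ℝ) 1 ∩ γ ⁻¹' Wᶜ).Nonempty := by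
    refine ⟨0, by simp, fun h0 => ?_⟩
    have := h0.2
    simp [hγ, hv, hC, supportFn_zero hne] at this
  -- The last parameter at which the segment from `x` to `y` is outside `W`. Since `γ s` is not in
  -- `W`, the increment bound is first proved for `t > s`, then passed to the limit.
  obtain ⟨s, ⟨hs01, hsW⟩, hsmax⟩ := hTc.exists_isGreatest hTne
  have hs1 : s < 1 := by
    refine lt_of_le_of_ne hs01.2 fun hs => hsW ?_
    rw [hs, hγ1]
    exact ⟨hy, hlt⟩
  have hin : ∀ t ∈ Ioc s 1, γ t ∈ W := fun t ht => by
    by_contra hc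
    exact absurd (hsmax ⟨⟨hs01.1.trans ht.1.le, ht.2⟩, hc⟩) (not_le.2 ht.1)
  have hsub : ∀ a b : ℝ, γ b - γ a = (b - a) • (y - x) := fun a b => by
    simp only [hγ]
    module
  have hstep : ∀ t ∈ Ioc s 1, u y - u (γ t) ≤ (1 - t) * C (y - x) := by
    intro t ht
    have hseg : segment ℝ (γ t) (γ 1) ⊆ W := by
      rintro _ ⟨a, b, ha, hb, hab, rfl⟩
      have hcomb : a • γ t + b • γ 1 = γ (a * t + b) := by
        have ha' : a = 1 - b := by linarith
        simp only [hγ, ha']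
        module
      rw [hcomb]
      refine hin _ ⟨?_, ?_⟩
      · have : a * s + b * s = s := by rw [← add_mul, hab, one_mul]
        rcases ha.eq_or_lt with h0 | h0
        · rw [← h0] at hab ⊢
          linarith
        · have := mul_lt_mul_of_pos_left ht.1 h0
          have := mul_le_mul_of_nonneg_left hs1.le hb
          linarith
      · have := mul_le_mul_of_nonneg_left ht.2 ha
        linarith
    have := sub_le_supportFn_of_supFunctional_le hcont hcoer hu hWo
      (h.memSobolevLoc.mono (subset_univ _)) hle hseg
    rwa [hsub, supportFn_smul hS hne (sub_nonneg.2 ht.2), hγ1] at this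
  have hlim : u y - u (γ s) ≤ (1 - s) * C (y - x) := by
    have hc1 : Continuous fun t => u y - u (γ t) := by fun_prop
    have hc2 : Continuous fun t : ℝ => (1 - t) * C (y - x) := by fun_prop
    refine le_of_tendsto_of_tendsto ((hc1.tendsto s).mono_left nhdsWithin_le_nhds)
      ((hc2.tendsto s).mono_left (nhdsWithin_le_nhds (s := Ioi s))) ?_
    filter_upwards [Ioc_mem_nhdsGT hs1] with t ht using hstep t ht
  have hus : u (γ s) ≤ u x + s * C (y - x) := by
    have h1 : u (γ s) ≤ v (γ s) := not_lt.1 fun h' => hsW ⟨hγball s hs01, h'⟩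
    have h2 : γ s - x = s • (y - x) := by simp [hγ]
    simp only [hv] at h1
    rwa [h2, hC, supportFn_smul hS hne hs01.1] at h1
  linarith

end AbsoluteMinimizer

/-! ### Touching cones: strict separation, and rigidity. -/

section Touching

variable {E : Type*} [NormedAddCommGroup E] [InnerProductSpace ℝ E] [ProperSpace E]
  {H u f : E → ℝ} {ι : Type*} {l : Filter ι}

omit [InnerProductSpace ℝ E] [ProperSpace E] in
/-- Pointwise convergence of equi-Lipschitz functions is uniform on compact sets. -/
theorem tendstoUniformlyOn_of_lipschitzWith {F : ι → E → ℝ} {L : NNReal}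
    (hF : ∀ j, LipschitzWith L (F j)) (hlim : ∀ x, Tendsto (fun j => F j x) l (𝓝 (f x)))
    {K : Set E} (hK : IsCompact K) : TendstoUniformlyOn F f l K := by
  have heq : ∀ K : Set E, K ∈ {K : Set E | IsCompact K} → EquicontinuousOn F K := fun K _ =>
    (LipschitzWith.uniformEquicontinuous F L hF).equicontinuous.equicontinuousOn K
  have h := (EquicontinuousOn.tendsto_uniformOnFun_iff_pi (𝔖 := {K : Set E | IsCompact K})
    (fun _ h => h) (sUnion_eq_univ_iff.2 fun x => ⟨{x}, isCompact_singleton, rfl⟩) heq l f).2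
    (tendsto_pi_nhds.2 hlim)
  exact UniformOnFun.tendsto_iff_tendstoUniformlyOn.1 h K hK

/-- If the limit of rescalings of `u` stays strictly below the cone of slope `K` on a sphere,
then `u` has slope less than `K` on the corresponding balls. -/
theorem ComparesWithConesAbove.exists_lt_of_forall_sphere_lt (hcont : Continuous H)
    (hconv : ConvexOn ℝ univ H) (hcoer : Tendsto H (Bornology.cobounded E) atTop)
    (hu : ComparesWithConesAbove H u) {p₀ : E} {K : ℝ} (hp₀ : H p₀ < K) {ρ : ι → ℝ}
    (hρ : ∀ᶠ j in l, 0 < ρ j) {c : E} {r : ℝ} (hr : 0 < r) (hf : Continuous f)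
    (hlim : TendstoUniformlyOn (fun j y => u (c + ρ j • y) / ρ j) f l (closedBall 0 r))
    (hlt : ∀ y ∈ sphere (0 : E) r, f y < f 0 + supportFn {p | H p ≤ K} y) :
    ∃ k < K, {p | H p ≤ k}.Nonempty ∧ ∃ δ > 0, ∀ᶠ j in l, ∀ x ∈ ball c (ρ j * δ),
      ∀ y ∈ ball c (ρ j * δ), u y - u x ≤ supportFn {p | H p ≤ k} (y - x) := by
  have hSK := isCompact_sublevel hcont hcoer K
  have hCc := continuous_supportFn hSK ⟨p₀, hp₀.le⟩
  set C := supportFn {p | H p ≤ K} with hC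
  have hG : Continuous fun z : E × E => f z.1 + C (z.2 - z.1) - f z.2 := by fun_prop
  obtain ⟨ε, hε, hεG⟩ : ∃ ε, 0 < ε ∧ ∀ y ∈ sphere (0 : E) r, ε ≤ f 0 + C y - f y :=
    (isCompact_sphere (0 : E) r).exists_forall_le' (by fun_prop)
      fun y hy => by linarith [hlt y hy]
  have hnear : ∀ᶠ x in 𝓝 (0 : E), ∀ y ∈ sphere (0 : E) r, ε / 2 < f x + C (y - x) - f y := by
    refine (isCompact_sphere (0 : E) r).eventually_forall_of_forall_eventually fun y hy => ?_
    refine hG.continuousAt.eventually (lt_mem_nhds ?_)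
    simpa using (half_lt_self hε).trans_le (hεG y hy)
  obtain ⟨δ, hδ, hδG⟩ := Metric.eventually_nhds_iff_ball.1 hnear
  -- Vertex and sphere point are at most `2 * r` apart. Lowering `K` to `k` and approximating `f` at
  -- two points cost `3 * ε / 8`, within the margin `ε / 2`.
  obtain ⟨k, hkK, hpk, hk⟩ := exists_lt_supportFn_sublevel_ge (r := 2 * r) hcont hconv hcoer hp₀
    (show 0 < ε / 8 by positivity)
  have hS := isCompact_sublevel hcont hcoer k
  have hne : {p | H p ≤ k}.Nonempty := ⟨p₀, hpk⟩
  refine ⟨k, hkK, hne, min δ r, lt_min hδ hr, ?_⟩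
  filter_upwards [hρ, Metric.tendstoUniformlyOn_iff.1 hlim (ε / 8) (by positivity)]
    with j hj hclose x hx y hy
  have hball : ∀ z ∈ ball c (ρ j * min δ r), z ∈ ball c (ρ j * r) := fun z hz =>
    ball_subset_ball (mul_le_mul_of_nonneg_left (min_le_right _ _) hj.le) hz
  have hscale : ∀ z : E, c + ρ j • ((ρ j)⁻¹ • (z - c)) = z := fun z => by
    rw [smul_smul, mul_inv_cancel₀ hj.ne', one_smul, add_sub_cancel]
  have hnorm : ∀ z : E, ‖(ρ j)⁻¹ • (z - c)‖ = dist z c / ρ j := fun z => by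
    rw [norm_smul, norm_inv, Real.norm_of_nonneg hj.le, dist_eq_norm, inv_mul_eq_div]
  have hx' : dist x c / ρ j < min δ r := by
    rw [div_lt_iff₀ hj, mul_comm]
    exact hx
  have key : ∀ z ∈ sphere c (ρ j * r), u z ≤ u x + supportFn {p | H p ≤ k} (z - x) := by
    intro z hz
    have hz' : dist z c / ρ j = r := by
      rw [div_eq_iff hj.ne', mul_comm]
      exact hz
    set a := (ρ j)⁻¹ • (x - c) with ha
    set b := (ρ j)⁻¹ • (z - c) with hb
    have hna : ‖a‖ < min δ r := by rw [hnorm]; exact hx'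
    have hnb : ‖b‖ = r := by rw [hnorm]; exact hz'
    have h1 := hδG a (mem_ball_zero_iff.2 (hna.trans_le (min_le_left _ _))) b
      (mem_sphere_zero_iff_norm.2 hnb)
    have h2 := hclose a (mem_closedBall_zero_iff.2 (hna.le.trans (min_le_right _ _)))
    have h3 := hclose b (mem_closedBall_zero_iff.2 hnb.le)
    rw [hscale, Real.dist_eq, abs_lt] at h2 h3
    have h4 := hk (b - a) ((norm_sub_le b a).trans (by
      have := hna.le.trans (min_le_right _ _)
      linarith))
    have hba : z - x = ρ j • (b - a) := by
      rw [hb, ha, ← smul_sub, smul_smul, mul_inv_cancel₀ hj.ne', one_smul,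
        sub_sub_sub_cancel_right]
    rw [hba, supportFn_smul hS hne hj.le]
    have h5 : u z / ρ j ≤ u x / ρ j + supportFn {p | H p ≤ k} (b - a) := by linarith [h2.1, h3.2]
    rw [div_le_iff₀ hj, add_mul, div_mul_cancel₀ _ hj.ne'] at h5
    linarith
  have := hu k hne c (ρ j * r) x (hball x hx) key y (hball y hy)
  linarith

omit [ProperSpace E] in
/-- Limits of maximizers are maximizers in the limit direction. -/
theorem mem_and_inner_eq_supportFn_of_tendsto [l.NeBot] {S : Set E} (hS : IsCompact S)
    (hne : S.Nonempty) {Q w : ι → E} {Q₀ e : E} {r : ι → ℝ} (hr : ∀ j, 0 < r j)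
    (hQ : ∀ j, Q j ∈ S) (hmax : ∀ j, inner ℝ (Q j) (w j) = supportFn S (w j))
    (hQlim : Tendsto Q l (𝓝 Q₀)) (hw : Tendsto (fun j => (r j)⁻¹ • w j) l (𝓝 e)) :
    Q₀ ∈ S ∧ inner ℝ Q₀ e = supportFn S e := by
  refine ⟨hS.isClosed.mem_of_tendsto hQlim (.of_forall hQ), ?_⟩
  refine tendsto_nhds_unique (hQlim.inner hw) ?_
  refine (((continuous_supportFn hS hne).tendsto e).comp hw).congr fun j => ?_
  rw [Function.comp_apply, supportFn_smul hS hne (inv_nonneg.2 (hr j).le), real_inner_smul_right,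
    hmax]

-- Limits along one ultrafilter replace repeated extraction of subsequences.
omit [InnerProductSpace ℝ E] [ProperSpace E] in
theorem exists_tendsto_ultrafilter {S : Set E} (hS : IsCompact S) (𝒰 : Ultrafilter ι) {s : ι → E}
    (hs : ∀ j, s j ∈ S) : ∃ a ∈ S, Tendsto s 𝒰 (𝓝 a) :=
  hS.ultrafilter_le_nhds' (𝒰.map s) (Ultrafilter.mem_map.2 (univ_mem' hs))

/-- A function of slope at most `K` that touches its cones of slope `K` on every sphere, from both
sides, is affine. -/
theorem exists_affine_of_forall_touching (hcont : Continuous H)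
    (hconv : ConvexOn ℝ univ H) (hcoer : Tendsto H (Bornology.cobounded E) atTop)
    (hA : ∀ c : ℝ, ∀ a b : E, a ≠ b → ¬ segment ℝ a b ⊆ H ⁻¹' {c}) {K : ℝ}
    (hne : {p | H p ≤ K}.Nonempty)
    (hf : ∀ x y, f y - f x ≤ supportFn {p | H p ≤ K} (y - x))
    (habove : ∀ r > 0, ∃ y, ‖y‖ = r ∧ f y = f 0 + supportFn {p | H p ≤ K} y)
    (hbelow : ∀ r > 0, ∃ z, ‖z‖ = r ∧ f 0 = f z + supportFn {p | H p ≤ K} (-z)) :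
    ∃ p, H p = K ∧ ∀ x, f x = f 0 + inner ℝ p x := by
  have hS := isCompact_sublevel hcont hcoer K
  set r : ℕ → ℝ := fun j => j + 1 with hr
  have hr0 : ∀ j, 0 < r j := fun j => by positivity
  choose y hyn hy using fun j => habove (r j) (hr0 j)
  choose z hzn hz using fun j => hbelow (r j) (hr0 j)
  set 𝒰 : Ultrafilter ℕ := hyperfilter ℕ
  have hrlim : Tendsto (fun j => (r j)⁻¹) 𝒰 (𝓝 0) :=
    (tendsto_inv_atTop_zero.comp
      (tendsto_atTop_add_const_right _ 1 tendsto_natCast_atTop_atTop)).mono_left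
      Nat.hyperfilter_le_atTop
  have hdir : ∀ w : ℕ → E, (∀ j, ‖w j‖ = r j) →
      ∃ e ∈ sphere (0 : E) 1, Tendsto (fun j => (r j)⁻¹ • w j) 𝒰 (𝓝 e) := fun w hw =>
    exists_tendsto_ultrafilter (isCompact_sphere 0 1) 𝒰 fun j => by
      rw [mem_sphere_zero_iff_norm, norm_smul, hw, norm_inv, Real.norm_of_nonneg (hr0 j).le,
        inv_mul_cancel₀ (hr0 j).ne']
  have hadd : ∀ (w : ℕ → E) (e x : E), Tendsto (fun j => (r j)⁻¹ • w j) 𝒰 (𝓝 e) →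
      Tendsto (fun j => (r j)⁻¹ • (w j + x)) 𝒰 (𝓝 e) := fun w e x hw => by
    simpa [smul_add] using hw.add (hrlim.smul_const x)
  obtain ⟨e, he, hye⟩ := hdir y hyn
  obtain ⟨e', he', hze⟩ := hdir (fun j => -z j) fun j => by rw [norm_neg, hzn]
  have he0 : e ≠ 0 := ne_zero_of_mem_unit_sphere ⟨e, he⟩
  have he0' : e' ≠ 0 := ne_zero_of_mem_unit_sphere ⟨e', he'⟩
  -- a common maximizer for the directions `y j` and `-z j`
  choose P hPS hP using fun j => exists_inner_eq_supportFn hS hne (y j + -z j)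
  -- The touching equalities give `f (y j) - f (z j)` as the sum of the two support values. It is at
  -- most the support value of `y j - z j`, so subadditivity is an equality and `P j` is optimal for
  -- both summands.
  have hPyz : ∀ j, inner ℝ (P j) (y j) = supportFn {p | H p ≤ K} (y j) ∧
      inner ℝ (P j) (-z j) = supportFn {p | H p ≤ K} (-z j) := fun j => by
    have h1 := hP j
    have h2 := hf (z j) (y j)
    rw [inner_add_right] at h1
    rw [sub_eq_add_neg (y j)] at h2
    have h3 := inner_le_supportFn hS (hPS j) (y j)
    have h4 := inner_le_supportFn hS (hPS j) (-z j)
    have h5 := hy j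
    have h6 := hz j
    constructor <;> linarith
  obtain ⟨p, -, hp⟩ := exists_tendsto_ultrafilter hS 𝒰 hPS
  obtain ⟨hpS, hpe⟩ := mem_and_inner_eq_supportFn_of_tendsto hS hne hr0 hPS
    (fun j => (hPyz j).1) hp hye
  obtain ⟨-, hpe'⟩ := mem_and_inner_eq_supportFn_of_tendsto hS hne hr0 hPS
    (fun j => (hPyz j).2) hp hze
  refine ⟨p, eq_of_inner_eq_supportFn hcont hcoer he0 hpS hpe, fun x => le_antisymm ?_ ?_⟩
  -- Upper bound from the cone with vertex `z j`. The shift by `x` is lost in the limit direction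
  -- `e'`, so `Q j` tends to the unique maximizer there, namely `p`.
  · choose Q hQS hQ using fun j => exists_inner_eq_supportFn hS hne (-z j + x)
    obtain ⟨q, -, hq⟩ := exists_tendsto_ultrafilter hS 𝒰 hQS
    obtain ⟨hqS, hqe⟩ := mem_and_inner_eq_supportFn_of_tendsto hS hne hr0 hQS hQ hq
      (hadd _ e' x hze)
    have hqp : q = p := eq_of_inner_eq_supportFn_of_forall_segment hcont hconv hcoer hA he0'
      hqS hpS hqe hpe'
    refine hqp ▸ ge_of_tendsto ((hq.inner tendsto_const_nhds).const_add (f 0))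
      (.of_forall fun j => ?_)
    have h1 := hf (z j) x
    rw [sub_eq_neg_add x, ← hQ j, inner_add_right] at h1
    have h2 := inner_le_supportFn hS (hQS j) (-z j)
    linarith [hz j]
  · choose Q hQS hQ using fun j => exists_inner_eq_supportFn hS hne (y j + -x)
    obtain ⟨q, -, hq⟩ := exists_tendsto_ultrafilter hS 𝒰 hQS
    obtain ⟨hqS, hqe⟩ := mem_and_inner_eq_supportFn_of_tendsto hS hne hr0 hQS hQ hq
      (hadd _ e (-x) hye)
    have hqp : q = p := eq_of_inner_eq_supportFn_of_forall_segment hcont hconv hcoer hA he0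
      hqS hpS hqe hpe
    refine hqp ▸ le_of_tendsto ((hq.inner tendsto_const_nhds).const_add (f 0))
      (.of_forall fun j => ?_)
    have h1 := hf x (y j)
    rw [sub_eq_add_neg (y j), ← hQ j, inner_add_right, inner_neg_right] at h1
    have h2 := inner_le_supportFn hS (hQS j) (y j)
    linarith [hy j]

end Touching

/-! ### Limits of rescalings, and the two conclusions. -/

section Blowup

variable {n : ℕ} {H u f : EuclideanSpace ℝ (Fin n) → ℝ}

theorem lipschitzWith_rescale {E : Type*} [NormedAddCommGroup E] [NormedSpace ℝ E] {u : E → ℝ}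
    {L : NNReal} (hu : LipschitzWith L u) (c : E) (ρ : ℝ) :
    LipschitzWith L fun y => u (c + ρ • y) / ρ := by
  refine LipschitzWith.of_dist_le_mul fun x y => ?_
  rcases eq_or_ne ρ 0 with rfl | hρ
  · simp only [div_zero, dist_self]
    positivity
  have h := hu.dist_le_mul (c + ρ • x) (c + ρ • y)
  rw [dist_add_left, dist_smul₀, Real.dist_eq] at h
  rw [Real.dist_eq, ← sub_div, abs_div, div_le_iff₀ (abs_pos.2 hρ)]
  rw [Real.norm_eq_abs] at h
  linarith

/-- Limits of rescalings of an absolute minimizer of maximal slope `K` are affine, as soon as the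
slope on the rescaled balls does not stay below any `k < K`. -/
theorem IsAbsoluteMinimizer.exists_affine_of_tendsto (hcont : Continuous H)
    (hconv : ConvexOn ℝ univ H)
    (hcoer : Tendsto H (Bornology.cobounded (EuclideanSpace ℝ (Fin n))) atTop)
    (hA : NoSegmentInLevelSets H) (hu : IsAbsoluteMinimizer H u univ) {K : ℝ}
    (hne : {p | H p ≤ K}.Nonempty)
    (huK : ∀ x y, u y - u x ≤ supportFn {p | H p ≤ K} (y - x))
    {ι : Type*} {l : Filter ι} [l.NeBot] {ρ : ι → ℝ} (hρ : ∀ᶠ j in l, 0 < ρ j)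
    {c : EuclideanSpace ℝ (Fin n)}
    (hlim : ∀ y, Tendsto (fun j => u (c + ρ j • y) / ρ j) l (𝓝 (f y)))
    (hslope : ∀ k < K, {p | H p ≤ k}.Nonempty → ∀ δ > 0, ¬ ∀ᶠ j in l, ∀ x ∈ ball c (ρ j * δ),
      ∀ y ∈ ball c (ρ j * δ), u y - u x ≤ supportFn {p | H p ≤ k} (y - x)) :
    ∃ p, H p = K ∧ ∀ x, f x = f 0 + inner ℝ p x := by
  have hS := isCompact_sublevel hcont hcoer K
  obtain ⟨L, hL⟩ := exists_norm_le_of_isCompact hS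
  have huL := lipschitzWith_of_sub_le_supportFn hne hL huK
  have hunif := fun r : ℝ => tendstoUniformlyOn_of_lipschitzWith
    (fun j => lipschitzWith_rescale huL c (ρ j)) hlim
    (isCompact_closedBall (0 : EuclideanSpace ℝ (Fin n)) r)
  have hfK : ∀ x y, f y - f x ≤ supportFn {p | H p ≤ K} (y - x) := by
    intro x y
    refine le_of_tendsto ((hlim y).sub (hlim x)) ?_
    filter_upwards [hρ] with j hj
    have h := huK (c + ρ j • x) (c + ρ j • y)
    rw [add_sub_add_left_eq_sub, ← smul_sub, supportFn_smul hS hne hj.le] at h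
    rw [← sub_div, div_le_iff₀ hj]
    linarith
  have hfc : Continuous f := (lipschitzWith_of_sub_le_supportFn hne hL hfK).continuous
  obtain ⟨p₀, hp₀, hmin⟩ := hS.exists_isMinOn hne hcont.continuousOn
  rcases (show H p₀ ≤ K from hp₀).eq_or_lt with heq | hlt
  -- If `K` is the minimum of `H`, (A) reduces the sublevel set to a point and the cone is linear;
  -- no smaller level is available for the touching argument.
  · have hsing : ∀ p, H p ≤ K → p = p₀ := by
      intro p hp
      by_contra hpp
      refine hA K p p₀ hpp fun q hq => ?_
      have hqK : H q ≤ K := by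
        have hc : Convex ℝ {p | H p ≤ K} := by simpa using hconv.convex_le K
        exact hc.segment_subset hp hp₀ hq
      exact le_antisymm hqK (heq ▸ hmin hqK)
    have hsupp : ∀ w, supportFn {p | H p ≤ K} w = inner ℝ p₀ w := fun w => by
      obtain ⟨p, hp, hpw⟩ := exists_inner_eq_supportFn hS hne w
      rw [← hpw, hsing p hp]
    refine ⟨p₀, heq, fun x => ?_⟩
    have h1 := hfK 0 x
    have h2 := hfK x 0
    rw [hsupp, inner_sub_right, inner_zero_right] at h1 h2
    linarith
  · have hCC := hu.comparesWithConesAbove hcont hconv hcoer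
    have hcont' : Continuous fun p => H (-p) := hcont.comp continuous_neg
    have hconv' : ConvexOn ℝ univ fun p => H (-p) := by
      exact hconv.comp_linearMap (-LinearMap.id)
    have hcoer' : Tendsto (fun p => H (-p))
        (Bornology.cobounded (EuclideanSpace ℝ (Fin n))) atTop :=
      hcoer.comp tendsto_neg_cobounded
    have hCC' := hu.neg.comparesWithConesAbove hcont' hconv' hcoer'
    have hneg : ∀ k w, supportFn {p | H (-p) ≤ k} w = supportFn {p | H p ≤ k} (-w) := fun k w =>
      supportFn_neg_preimage {p | H p ≤ k} w
    refine exists_affine_of_forall_touching hcont hconv hcoer hA hne hfK ?_ ?_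
    · intro r hr
      by_contra! hno
      obtain ⟨k, hk, hkne, δ, hδ, hev⟩ := hCC.exists_lt_of_forall_sphere_lt hcont hconv hcoer hlt
        hρ hr hfc (hunif r) fun y hy => by
          have h1 := hfK 0 y
          rw [sub_zero] at h1
          exact lt_of_le_of_ne (by linarith) (hno y (mem_sphere_zero_iff_norm.1 hy))
      exact hslope k hk hkne δ hδ hev
    · intro r hr
      by_contra! hno
      have hunif' : TendstoUniformlyOn (fun j y => -u (c + ρ j • y) / ρ j) (fun y => -f y) l
          (closedBall 0 r) := by
        simp only [neg_div]
        exact (hunif r).neg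
      obtain ⟨k, hk, ⟨q, hq⟩, δ, hδ, hev⟩ := hCC'.exists_lt_of_forall_sphere_lt hcont' hconv'
        hcoer' (p₀ := -p₀) (by simpa using hlt) hρ hr hfc.neg hunif' fun y hy => by
          have h1 := hfK y 0
          rw [zero_sub] at h1
          have h2 := lt_of_le_of_ne (show f 0 ≤ f y + supportFn {p | H p ≤ K} (-y) by linarith)
            (hno y (mem_sphere_zero_iff_norm.1 hy))
          rw [hneg, Pi.neg_apply, Pi.neg_apply]
          linarith
      refine hslope k hk ⟨-q, hq⟩ δ hδ (hev.mono fun j hj x hx y hy => ?_)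
      have := hj y hy x hx
      rw [hneg, neg_sub] at this
      linarith

/-- A finite value of the functional on the whole space is a real number, and it controls all
increments. -/
theorem exists_coe_eq_supFunctional_univ (hcont : Continuous H)
    (hcoer : Tendsto H (Bornology.cobounded (EuclideanSpace ℝ (Fin n))) atTop)
    (hu : IsAbsoluteMinimizer H u univ) (hlt : supFunctional H u univ < ⊤) :
    ∃ K : ℝ, supFunctional H u univ = K ∧ {p | H p ≤ K}.Nonempty ∧
      ∀ x y, u y - u x ≤ supportFn {p | H p ≤ K} (y - x) := by
  -- The whole space has positive measure, so an a.e. bound holds at some point, where `H` is real.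
  have hnb : supFunctional H u univ ≠ ⊥ := by
    intro hb
    have h1 := ae_le_essSup (f := fun x => (H (weakGrad u univ x) : EReal))
      (μ := volume.restrict univ)
    obtain ⟨x, hx⟩ := h1.exists
    have h2 : ((H (weakGrad u univ x) : ℝ) : EReal) ≤ ⊥ := hx.trans hb.le
    exact EReal.coe_ne_bot _ (le_bot_iff.1 h2)
  lift supFunctional H u univ to ℝ using ⟨hlt.ne, hnb⟩ with K hK
  obtain ⟨x, hx⟩ := (ae_le_of_supFunctional_le hK.ge).exists
  exact ⟨K, rfl, ⟨_, hx⟩, fun x y => sub_le_supportFn_of_supFunctional_le hcont hcoer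
    hu.continuous isOpen_univ hu.memSobolevLoc hK.ge (subset_univ _)⟩

/-- Absolute minimizers of linear growth have finite energy. -/
theorem IsAbsoluteMinimizer.supFunctional_lt_top_of_hasLinearGrowth (hcont : Continuous H)
    (hconv : ConvexOn ℝ univ H)
    (hcoer : Tendsto H (Bornology.cobounded (EuclideanSpace ℝ (Fin n))) atTop)
    (hu : IsAbsoluteMinimizer H u univ) (hgrowth : HasLinearGrowth u) :
    supFunctional H u univ < ⊤ := by
  obtain ⟨C, hC, hCu⟩ := hgrowth
  obtain ⟨k, hne, hk⟩ := exists_mul_norm_le_supportFn_sublevel hcont hcoer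
    (show 0 ≤ C + 1 by positivity)
  have hS := isCompact_sublevel hcont hcoer k
  have hinc : ∀ x y, u y - u x ≤ supportFn {p | H p ≤ k} (y - x) := by
    intro x y
    have hCC := hu.comparesWithConesAbove hcont hconv hcoer
    -- On the sphere of radius `R` the growth bound gives `u z - u x ≤ C * R + 2 * C * (1 + ‖x‖) ≤
    -- (C + 1) * R`; the remaining terms put `y` inside the ball.
    set R := 2 * C * (1 + ‖x‖) + dist y x + 1 with hR
    have hR0 : 0 ≤ 2 * C * (1 + ‖x‖) := by positivity
    have := hCC k hne x R x (mem_ball_self (by positivity)) (fun z hz => by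
      have h1 : ‖z - x‖ = R := by rw [← dist_eq_norm]; exact hz
      have h2 := hk (z - x)
      have h3 := (abs_le.1 (hCu z)).2
      have h4 := (abs_le.1 (hCu x)).1
      have h5 : ‖z‖ ≤ R + ‖x‖ := by
        have := norm_add_le (z - x) x
        rwa [sub_add_cancel, h1] at this
      have h6 := mul_le_mul_of_nonneg_left h5 hC.le
      rw [h1] at h2
      have h7 : 0 ≤ dist y x := dist_nonneg
      linarith) y (mem_ball.2 (by linarith))
    linarith
  obtain ⟨L, hL⟩ := exists_norm_le_of_isCompact hS
  exact (supFunctional_le_of_forall_sub_le hcont hconv hcoer hne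
    (lipschitzWith_of_sub_le_supportFn hne hL hinc) isOpen_univ
    fun x _ y _ => hinc x y).trans_lt (EReal.coe_lt_top k)

/-- An absolute minimizer on the whole space whose slope is attained at a point is affine. -/
theorem IsAbsoluteMinimizer.exists_affine_of_hasSlope (hcont : Continuous H)
    (hconv : ConvexOn ℝ univ H)
    (hcoer : Tendsto H (Bornology.cobounded (EuclideanSpace ℝ (Fin n))) atTop)
    (hA : NoSegmentInLevelSets H) (hu : IsAbsoluteMinimizer H u univ)
    {x₀ : EuclideanSpace ℝ (Fin n)} (hslope : HasSlope H u x₀ (supFunctional H u univ))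
    (hlt : supFunctional H u univ < ⊤) :
    ∃ (p : EuclideanSpace ℝ (Fin n)) (b : ℝ), (∀ x, u x = inner ℝ p x + b) ∧
      (H p : EReal) = supFunctional H u univ := by
  obtain ⟨K, hK, hne, huK⟩ := exists_coe_eq_supFunctional_univ hcont hcoer hu hlt
  obtain ⟨L, hL⟩ := exists_norm_le_of_isCompact (isCompact_sublevel hcont hcoer K)
  have huL := lipschitzWith_of_sub_le_supportFn hne hL huK
  -- A constant family with scale `1`: `u` translated to `x₀` is its own limit. Slope at most `k`
  -- near `x₀` would contradict `HasSlope`.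
  obtain ⟨p, hp, hf⟩ := hu.exists_affine_of_tendsto (f := fun y => u (x₀ + y)) hcont hconv hcoer
    hA hne huK (l := pure ()) (ρ := fun _ => 1) (c := x₀) (by simp) (fun y => by
      simp only [one_smul, div_one]
      exact tendsto_const_nhds) (fun k hk hkne δ hδ hev => by
      simp only [one_mul, eventually_pure] at hev
      refine absurd (le_of_tendsto hslope ?_) (not_le.2 (hK ▸ EReal.coe_lt_coe_iff.2 hk))
      filter_upwards [Ioo_mem_nhdsGT hδ] with r hr
      exact supFunctional_le_of_forall_sub_le hcont hconv hcoer hkne huL isOpen_ball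
        fun x hx y hy => hev x (ball_subset_ball hr.2.le hx) y (ball_subset_ball hr.2.le hy))
  refine ⟨p, u x₀ - inner ℝ p x₀, fun x => ?_, by rw [hp, hK]⟩
  have := hf (x - x₀)
  simp only [add_sub_cancel, add_zero, inner_sub_right] at this
  linarith

/-- Absolute minimizers of linear growth have the linear approximation property at infinity. -/
theorem IsAbsoluteMinimizer.hasLinearApproxAtInfinity (hcont : Continuous H)
    (hconv : ConvexOn ℝ univ H)
    (hcoer : Tendsto H (Bornology.cobounded (EuclideanSpace ℝ (Fin n))) atTop)
    (hA : NoSegmentInLevelSets H) (hu : IsAbsoluteMinimizer H u univ)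
    (hgrowth : HasLinearGrowth u) : HasLinearApproxAtInfinity H u := by
  obtain ⟨K, hK, hne, huK⟩ := exists_coe_eq_supFunctional_univ hcont hcoer hu
    (hu.supFunctional_lt_top_of_hasLinearGrowth hcont hconv hcoer hgrowth)
  obtain ⟨L, hL⟩ := exists_norm_le_of_isCompact (isCompact_sublevel hcont hcoer K)
  have huL := lipschitzWith_of_sub_le_supportFn hne hL huK
  intro R hR
  set 𝒰 : Ultrafilter ℕ := hyperfilter ℕ
  have h𝒰 : (𝒰 : Filter ℕ) ≤ atTop := Nat.hyperfilter_le_atTop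
  have hR𝒰 : Tendsto R 𝒰 atTop := hR.mono_left h𝒰
  set v : ℕ → EuclideanSpace ℝ (Fin n) → ℝ := fun j y => u (0 + R j • y) / R j with hv
  have hvL : ∀ j, LipschitzWith L (v j) := fun j => lipschitzWith_rescale huL 0 (R j)
  have hv0 : Tendsto (fun j => v j 0) 𝒰 (𝓝 0) := by
    simp only [hv, smul_zero, add_zero]
    exact hR𝒰.const_div_atTop _
  have hex : ∀ y, ∃ a, Tendsto (fun j => v j y) 𝒰 (𝓝 a) := by
    intro y
    obtain ⟨a, -, ha⟩ := exists_tendsto_ultrafilter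
      (isCompact_closedBall (0 : ℝ) (L * ‖y‖)) 𝒰 (s := fun j => v j y - v j 0) fun j => by
        rw [mem_closedBall_zero_iff, ← dist_eq_norm]
        simpa using (hvL j).dist_le_mul y 0
    exact ⟨a + 0, by simpa using ha.add hv0⟩
  choose f hf using hex
  obtain ⟨p, hp, hfp⟩ := hu.exists_affine_of_tendsto hcont hconv hcoer hA hne huK
    (hR𝒰.eventually_gt_atTop 0) hf (fun k hk hkne δ hδ hev => by
      refine absurd (supFunctional_le_of_forall_sub_le hcont hconv hcoer hkne huL isOpen_univ
        fun x _ y _ => ?_) (not_le.2 (hK ▸ EReal.coe_lt_coe_iff.2 hk))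
      -- The balls of radius `R j * δ` eventually contain any two points, so slope `k` on them would
      -- be global, against the definition of `K`.
      have hbig := (hR𝒰.atTop_mul_const hδ).eventually_gt_atTop (max ‖x‖ ‖y‖)
      obtain ⟨j, hj, hjR⟩ := (hev.and hbig).exists
      exact hj x (mem_ball_zero_iff.2 ((le_max_left _ _).trans_lt hjR)) y
        (mem_ball_zero_iff.2 ((le_max_right _ _).trans_lt hjR)))
  have hf0 : f 0 = 0 := tendsto_nhds_unique (hf 0) hv0
  have hunif := tendstoUniformlyOn_of_lipschitzWith hvL hf
    (isCompact_closedBall (0 : EuclideanSpace ℝ (Fin n)) 1)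
  -- What holds eventually along the ultrafilter holds frequently along `atTop`, which is enough to
  -- extract a genuine subsequence.
  have hfreq : ∀ m : ℕ, ∃ᶠ j in atTop, ∀ y ∈ closedBall (0 : EuclideanSpace ℝ (Fin n)) 1,
      dist (f y) (v j y) < 1 / ((m : ℝ) + 1) := fun m =>
    ((Metric.tendstoUniformlyOn_iff.1 hunif _ Nat.one_div_pos_of_nat).frequently).filter_mono h𝒰
  obtain ⟨k, hk, hkm⟩ := extraction_forall_of_frequently hfreq
  refine ⟨k, p, hk, Metric.tendstoUniformlyOn_iff.2 fun ε hε => ?_, by rw [hp, hK]⟩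
  filter_upwards [tendsto_one_div_add_atTop_nhds_zero_nat.eventually (gt_mem_nhds hε)]
    with m hm y hy
  have h := (hkm m y (ball_subset_closedBall hy)).trans hm
  rw [hfp, hf0, zero_add] at h
  simpa [hv] using h

end Blowup

theorem corollary5p3 {n : ℕ} (hn : 2 ≤ n) (H : EuclideanSpace ℝ (Fin n) → ℝ)
    (hcont : Continuous H) (hconv : ConvexOn ℝ univ H)
    (hcoer : Tendsto H (Bornology.cobounded (EuclideanSpace ℝ (Fin n))) atTop)
    (hA : NoSegmentInLevelSets H) :
    (∀ (u : EuclideanSpace ℝ (Fin n) → ℝ) (x₀ : EuclideanSpace ℝ (Fin n)),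
      IsAbsoluteMinimizer H u univ →
      HasSlope H u x₀ (supFunctional H u univ) →
      supFunctional H u univ < ⊤ →
      (∃ (p : EuclideanSpace ℝ (Fin n)) (b : ℝ), ∀ x, u x = inner ℝ p x + b) ∧
        (H (gradient u x₀) : EReal) = supFunctional H u univ) ∧
    (∀ u : EuclideanSpace ℝ (Fin n) → ℝ,
      IsAbsoluteMinimizer H u univ → HasLinearGrowth u → HasLinearApproxAtInfinity H u) := by
  refine ⟨fun u x₀ hu hslope hlt => ?_, fun u hu hgrowth =>
    hu.hasLinearApproxAtInfinity hcont hconv hcoer hA hgrowth⟩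
  obtain ⟨p, b, hpb, hp⟩ := hu.exists_affine_of_hasSlope hcont hconv hcoer hA hslope hlt
  refine ⟨⟨p, b, hpb⟩, ?_⟩
  have hgrad : gradient u x₀ = p := by
    refine ext_inner_right ℝ fun w => ?_
    have hd : HasFDerivAt u (innerSL ℝ p) x₀ := by
      rw [show u = fun x => innerSL ℝ p x + b from funext hpb]
      exact (innerSL ℝ p).hasFDerivAt.add_const b
    rw [inner_gradient_left, hd.fderiv, innerSL_apply_apply]
  rw [hgrad, hp]
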